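/- Let $d\ge 0$ and let $\Delta_d=\{x\in\mathbb R^{d+1}: x_i\ge 0,\ \sum_{i=0}^d x_i=1\}$ parametrize the divisions of a total rent of $1$ among $d+1$ rooms $0,\dots,d$, where $x_i$ is the rent of room $i$. The preferences of a tenant are given by sets $C_0,\dots,C_d\subseteq\Delta_d$, where $x\in C_i$ means that for the rent division $x$ the tenant weakly prefers room $i$ over the other rooms. They form a *dual KKM cover* if all $C_i$ are closed, $\bigcup_{i=0}^d C_i=\Delta_d$, and for every proper subset $I\subsetneq\{0,\dots,d\}$ the face $\{x\in\Delta_d: x_i=0\text{ for all }i\notin I\}$ is contained in $\bigcup_{i\notin I}C_i$ (this expresses that a free room is preferred over a nonfree one). Suppose that the preferences $C^j_0,\dots,C^j_d$ of $d$ tenants $j=1,\dots,d$ are known and that each is a dual KKM cover. Then there is a rent division $x\in\Delta_d$, depending only on these $d$ covers, such that: 1. for every room $i\in\{0,\dots,d\}$ (which the absent tenant may take) there is a bijection $\pi_i\colon\{1,\dots,d\}\to\{0,\dots,d\}\setminus\{i\}$ with $x\in C^1_{\pi_i(1)}\cap\dots\cap C^d_{\pi_i(d)}$; 2. $x$ is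 an envy-free division for all $d+1$ tenants whatever the secret preferences of the remaining tenant $0$ are: for all sets $C^0_0,\dots,C^0_d$ with $\Delta_d\subseteq\bigcup_i C^0_i$ (in particular for every dual KKM cover) there is a bijection $\sigma$ of $\{0,\dots,d\}$ with $x\in C^j_{\sigma(j)}$ for all $j\in\{0,\dots,d\}$. -/

import Mathlib

/-- The face of the standard simplex in `ℝ^(d+1)` determined by a set `I` of vertices. -/
def simplexFace (d : ℕ) (I : Finset (Fin (d + 1))) : Set (Fin (d + 1) → ℝ) :=
  {x | x ∈ stdSimplex ℝ (Fin (d + 1)) ∧ ∀ i, i ∉ I → x i = 0}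

/-- A dual KKM cover of the `d`-simplex. As the preference sets of a tenant: `x ∈ C i` means that
for the rent division `x` the tenant weakly prefers room `i` over the other rooms. -/
structure IsDualKKMCover (d : ℕ) (C : Fin (d + 1) → Set (Fin (d + 1) → ℝ)) : Prop where
  isClosed : ∀ i, IsClosed (C i)
  subset : ∀ i, C i ⊆ stdSimplex ℝ (Fin (d + 1))
  face_subset : ∀ I : Finset (Fin (d + 1)), I ≠ Finset.univ →
    simplexFace d I ⊆ ⋃ i ∈ {i | i ∉ I}, C i
  iUnion_eq : ⋃ i, C i = stdSimplex ℝ (Fin (d + 1))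

/-- The rent division `x` is envy-free for the `d + 1` tenants with preference sets
`P t i` (tenant `t`, room `i`): the tenants can be bijectively assigned to the rooms so that each
of them weakly prefers the room she gets. -/
def IsEnvyFreeDivision (d : ℕ) (P : Fin (d + 1) → Fin (d + 1) → Set (Fin (d + 1) → ℝ))
    (x : Fin (d + 1) → ℝ) : Prop :=
  ∃ σ : Equiv.Perm (Fin (d + 1)), ∀ t, x ∈ P t (σ t)

/-!
A rent division `x` has the desired property as soon as there is a `d × (d + 1)` matrix `A` of
nonnegative weights with row sums `1` and equal column sums `d / (d + 1)` such that `A j i ≠ 0` only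
if tenant `j` prefers room `i` at `x`. Indeed, any nonempty set `I` of tenants then has preferred
rooms of total weight at least `|I|`, hence strictly more than `|I|` of them; this leaves Hall's
condition true when any one room is removed (`exists_equiv_ne_of_column_sums`). The secretive tenant
may therefore take whatever room she likes.

The matrix comes from a fixed point argument for the average of the preferences. For each tenant, a
partition of unity subordinate to thickenings of her preference sets maps the simplex to itself; the
sum of these maps has total weight `d`, so that at each point some room has weight at least
`d / (d + 1)`. The covering lemma `exists_mem_stdSimplex_forall_eq_zero_or_mem` gives a point `z` at
which this holds for all rooms `i` with `z i ≠ 0`, and the thickenings are shrunk to nothing by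
compactness (`exists_matrix_of_closed_covers`). To exclude `z i = 0`, the preferences are pulled
back along a map `shrinkSimplex` of the simplex that sends a collar of the boundary to the boundary.
On the collar the dual KKM condition allows one to keep only the rooms with small coordinate
(`enlargedCover`), and a room with `z i = 0` would make all rooms have small coordinate.

The covering lemma is deduced from Scarf's lemma (`exists_dominating_image_eq_univ`), a statement
about finitely many points ranked by several linear orders, which is proved by a parity count and is
applied to the points of a fine grid in the simplex, ranked by their coordinates. This avoids
triangulations.
-/

/-! ### Dominating sets and Scarf's lemma -/

section Scarf

variable {ι V α : Type*} [LinearOrder α]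

/-- A finite set `B` is dominating for the rankings `r i` of `V` if no element of `V` beats, for
every `i` simultaneously, the `r i`-smallest element of `B`. -/
def Dominating (r : ι → V → α) (B : Finset V) : Prop :=
  ∀ y, ∃ i, ∀ x ∈ B, r i y ≤ r i x

theorem Dominating.mono {r : ι → V → α} {A B : Finset V} (hB : Dominating r B) (h : A ⊆ B) :
    Dominating r A := fun y => (hB y).imp fun _ hi x hx => hi x (h hx)

variable [DecidableEq V]

open Classical in
/-- The elements that extend `T` to a larger dominating set. -/
noncomputable def extensions [Fintype V] (r : ι → V → α) (T : Finset V) : Finset V :=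
  Finset.univ.filter fun x => x ∉ T ∧ Dominating r (insert x T)

theorem mem_extensions [Fintype V] {r : ι → V → α} {T : Finset V} {x : V} :
    x ∈ extensions r T ↔ x ∉ T ∧ Dominating r (insert x T) := by
  simp [extensions]

variable [Fintype ι] [DecidableEq ι]

/-- A surjection onto `T` from a type with one element more identifies just one pair `i`, `j`. -/
theorem exists_unique_collision {T : Finset V} (hcard : T.card + 1 = Fintype.card ι) (m : ι → V)
    (hmem : ∀ i, m i ∈ T) (hsurj : ∀ x ∈ T, ∃ i, m i = x) :
    ∃ i j, i ≠ j ∧ m i = m j ∧ ∀ k l, k ≠ l → m k = m l → (k = i ∨ k = j) := by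
  obtain ⟨i, -, j, -, hij, hm⟩ := Finset.exists_ne_map_eq_of_card_lt_of_maps_to
    (s := (Finset.univ : Finset ι)) (t := T) (by rw [Finset.card_univ]; omega)
    (f := m) (fun i _ => hmem i)
  refine ⟨i, j, hij, hm, fun k l hkl hkm => ?_⟩
  by_contra! hk
  -- Otherwise `m` maps the complement of `{i, k}` onto `T`, although it has fewer elements.
  have hsub : T ⊆ ((Finset.univ.erase i).erase k).image m := by
    intro x hx
    obtain ⟨p, rfl⟩ := hsurj x hx
    by_cases hpi : p = i
    · subst hpi
      exact Finset.mem_image.2 ⟨j, by simp [hij.symm, hk.2.symm], hm.symm⟩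
    by_cases hpk : p = k
    · subst hpk
      by_cases hli : l = i
      · exact Finset.mem_image.2 ⟨j, by simp [hij.symm, hk.2.symm], by rw [← hm, ← hli, hkm]⟩
      · exact Finset.mem_image.2 ⟨l, by simp [hli, hkl.symm], hkm.symm⟩
    · exact Finset.mem_image.2 ⟨p, by simp [hpi, hpk], rfl⟩
  have h1 := (Finset.card_le_card hsub).trans Finset.card_image_le
  rw [Finset.card_erase_of_mem (by simp [hk.1]), Finset.card_erase_of_mem (by simp),
    Finset.card_univ] at h1
  have : 0 < T.card := Finset.card_pos.2 ⟨_, hmem i⟩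
  omega

/-- The pivoting step of Scarf's lemma. If a dominating set `T` has one element less than there are
rankings, then exactly two rankings `i` and `j` have the same smallest element in `T`. With `M k`
the set of elements that beat `T` in all rankings but `k`, the elements by which `T` can be extended
to a larger dominating set are the `r k`-largest elements of `M k` for `k = i, j`. -/
theorem Dominating.exists_critical_pair {r : ι → V → α} (hr : ∀ i, Function.Injective (r i))
    {T : Finset V} (hT : Dominating r T) (hne : T.Nonempty)
    (hcard : T.card + 1 = Fintype.card ι) :
    ∃ (i j : ι) (M : ι → Set V), i ≠ j ∧
      (∀ k y, y ∈ M k ↔ ∀ l, l ≠ k → ∃ t ∈ T, r l t < r l y) ∧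
      (∃ t ∈ T, (∀ x ∈ T, r i t ≤ r i x) ∧ ∀ x ∈ T, r j t ≤ r j x) ∧
      (∀ x, (x ∉ T ∧ Dominating r (insert x T)) ↔
        ∃ k, (k = i ∨ k = j) ∧ x ∈ M k ∧ ∀ y ∈ M k, r k y ≤ r k x) ∧
      Disjoint (M i) (M j) := by
  choose m hmT hmin using fun i => T.exists_min_image (r i) hne
  have hsurj : ∀ x ∈ T, ∃ i, m i = x := by
    intro x hx
    obtain ⟨i, hi⟩ := hT x
    exact ⟨i, hr i (le_antisymm (hmin i x hx) (hi _ (hmT i)))⟩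
  obtain ⟨i, j, hij, hmij, huniq⟩ := exists_unique_collision hcard m hmT hsurj
  have hdisj : ∀ k l, k ≠ l → ∀ y, (∀ p, p ≠ k → ∃ t ∈ T, r p t < r p y) →
      (∀ p, p ≠ l → ∃ t ∈ T, r p t < r p y) → False := by
    intro k l hkl y h1 h2
    obtain ⟨p, hp⟩ := hT y
    by_cases hpk : p = k
    · obtain ⟨t, ht, hlt⟩ := h2 p (by rintro rfl; exact hkl hpk.symm)
      exact (hp t ht).not_gt hlt
    · obtain ⟨t, ht, hlt⟩ := h1 p hpk
      exact (hp t ht).not_gt hlt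
  refine ⟨i, j, fun k => {y | ∀ l, l ≠ k → ∃ t ∈ T, r l t < r l y}, hij, fun _ _ => Iff.rfl,
    ⟨m i, hmT i, hmin i, by rw [hmij]; exact hmin j⟩, ?_,
    Set.disjoint_left.2 fun y h1 h2 => hdisj i j hij y h1 h2⟩
  intro x
  constructor
  · rintro ⟨hxT, hx⟩
    obtain ⟨k, hk⟩ := hx x
    -- Every `t ∈ T` is the smallest element of `insert x T` for some ranking other than `k`.
    have hown : ∀ t ∈ T, ∃ l, l ≠ k ∧ m l = t ∧ r l t < r l x := by
      intro t ht
      obtain ⟨l, hl⟩ := hx t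
      have hne' : r l t ≠ r l x := fun h => hxT (hr l h ▸ ht)
      have hlt : r l t < r l x := lt_of_le_of_ne (hl x (by simp)) hne'
      refine ⟨l, ?_, hr l (le_antisymm (hmin l t ht)
        (hl _ (Finset.mem_insert_of_mem (hmT l)))), hlt⟩
      rintro rfl
      exact (hk t (Finset.mem_insert_of_mem ht)).not_gt hlt
    have hkij : k = i ∨ k = j := by
      obtain ⟨l, hlk, hml, -⟩ := hown (m k) (hmT k)
      exact huniq k l hlk.symm hml.symm
    refine ⟨k, hkij, ?_, ?_⟩
    · intro l hlk
      obtain ⟨l', hl'k, hml', hlt⟩ := hown (m l) (hmT l)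
      by_cases h : l = l'
      · subst h; exact ⟨m l, hmT l, hlt⟩
      · have h1 := huniq l l' h hml'.symm
        have h2 := huniq l' l (Ne.symm h) hml'
        exfalso
        rcases hkij with rfl | rfl <;> grind
    · intro y hy
      obtain ⟨l, hl⟩ := hx y
      by_cases hlk : l = k
      · subst hlk; exact hl x (by simp)
      · obtain ⟨t, ht, hlt⟩ := hy l hlk
        exact absurd hlt (hl t (Finset.mem_insert_of_mem ht)).not_gt
  · rintro ⟨k, hkij, hxM, hxmax⟩
    have hk : ∀ y, (∀ l, l ≠ k → ∃ t ∈ T, r l t < r l y) → ∀ t ∈ T, r k y ≤ r k t := by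
      intro y hy
      obtain ⟨l, hl⟩ := hT y
      by_cases hlk : l = k
      · subst hlk; exact hl
      · obtain ⟨t, ht, hlt⟩ := hy l hlk
        exact absurd hlt (hl t ht).not_gt
    refine ⟨fun hxT => ?_, fun y => ?_⟩
    · -- An element of `T` is never in `M k`, as it is `m l` for some `l ≠ k`.
      have : ∃ l, l ≠ k ∧ m l = x := by
        obtain ⟨l, hl⟩ := hsurj x hxT
        by_cases hlk : l = k
        · rcases hkij with rfl | rfl
          · exact ⟨j, hij.symm, by rw [← hmij, ← hlk, hl]⟩
          · exact ⟨i, hij, by rw [hmij, ← hlk, hl]⟩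
        · exact ⟨l, hlk, hl⟩
      obtain ⟨l, hlk, rfl⟩ := this
      obtain ⟨t, ht, hlt⟩ := hxM l hlk
      exact (hmin l t ht).not_gt hlt
    · by_cases hy : ∀ l, l ≠ k → ∃ t ∈ T, r l t < r l y
      · refine ⟨k, fun z hz => ?_⟩
        rcases Finset.mem_insert.1 hz with rfl | hz
        · exact hxmax y hy
        · exact hk y hy z hz
      · push Not at hy
        obtain ⟨l, hlk, hl⟩ := hy
        refine ⟨l, fun z hz => ?_⟩
        rcases Finset.mem_insert.1 hz with rfl | hz
        · obtain ⟨t, ht, hlt⟩ := hxM l hlk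
          exact (hl t ht).trans hlt.le
        · exact hl z hz

/-- If a coloured set of `card ι` elements misses a colour, then an even number of its elements can
be removed to leave exactly the colours other than `i₀`: none, or two of the same colour. -/
theorem even_card_filter_image_erase (c : V → ι) (i₀ : ι) {B : Finset V}
    (hB : B.card = Fintype.card ι) (hc : B.image c ≠ Finset.univ) :
    Even (B.filter fun x => (B.erase x).image c = Finset.univ.erase i₀).card := by
  rcases Finset.eq_empty_or_nonempty
    (B.filter fun x => (B.erase x).image c = Finset.univ.erase i₀) with h | ⟨x, hx⟩
  · simp [h]
  obtain ⟨hxB, hx⟩ := Finset.mem_filter.1 hx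
  have hinj : ∀ z ∈ B, (B.erase z).image c = Finset.univ.erase i₀ →
      Set.InjOn c (B.erase z : Finset V) := by
    intro z hz h
    rw [← Finset.card_image_iff, h, Finset.card_erase_of_mem hz, hB,
      Finset.card_erase_of_mem (Finset.mem_univ _), Finset.card_univ]
  have hcx : c x ≠ i₀ := by
    intro h
    apply hc
    rw [← Finset.insert_erase hxB, Finset.image_insert, hx, h,
      Finset.insert_erase (Finset.mem_univ _)]
  have hcx' : c x ∈ (B.erase x).image c := by rw [hx]; simp [hcx]
  obtain ⟨x', hx', hxx'⟩ := Finset.mem_image.1 hcx'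
  have hne : x' ≠ x := (Finset.mem_erase.1 hx').1
  have hx'B : x' ∈ B := (Finset.mem_erase.1 hx').2
  have : (B.filter fun z => (B.erase z).image c = Finset.univ.erase i₀) = {x, x'} := by
    ext z
    simp only [Finset.mem_filter, Finset.mem_insert, Finset.mem_singleton]
    constructor
    · rintro ⟨hz, hzc⟩
      by_contra! h
      exact hne (hinj z hz hzc (by simp [hx'B, h.2.symm]) (by simp [hxB, h.1.symm]) hxx')
    · rintro (rfl | rfl)
      · exact ⟨hxB, hx⟩
      · refine ⟨hx'B, ?_⟩
        rw [← hx]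
        ext k
        simp only [Finset.mem_image, Finset.mem_erase]
        constructor
        · rintro ⟨a, ⟨ha, haB⟩, rfl⟩
          by_cases hax : a = x
          · exact ⟨z, ⟨hne, hx'B⟩, by rw [hax, hxx']⟩
          · exact ⟨a, ⟨hax, haB⟩, rfl⟩
        · rintro ⟨a, ⟨ha, haB⟩, rfl⟩
          by_cases hax : a = z
          · exact ⟨x, ⟨hne.symm, hxB⟩, by rw [hax, hxx']⟩
          · exact ⟨a, ⟨hax, haB⟩, rfl⟩
  rw [this, Finset.card_pair hne.symm]
  exact even_two

variable [Fintype V]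

/-- A set containing an element `t` below the slack vectors `s j` has zero or two extensions: such
`t` makes both sets `M k` of the pivoting step nonempty, as `s k` belongs to `M k`. -/
theorem even_card_extensions {r : ι → V → α} (hr : ∀ i, Function.Injective (r i)) {s : ι → V}
    {T : Finset V} (hcard : T.card + 1 = Fintype.card ι) {t : V} (ht : t ∈ T)
    (hs : ∀ i j, j ≠ i → r i t < r i (s j)) : Even (extensions r T).card := by
  by_cases hT : Dominating r T
  swap
  · have : extensions r T = ∅ := by
      ext x
      simp only [mem_extensions, Finset.notMem_empty, iff_false, not_and]
      exact fun _ h => hT (h.mono (Finset.subset_insert _ _))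
    simp [this]
  obtain ⟨i, j, M, hij, hM, -, hX, hdisj⟩ := hT.exists_critical_pair hr ⟨t, ht⟩ hcard
  have hne : ∀ k, (M k).Nonempty := fun k => ⟨s k, (hM k _).2 fun l hl => ⟨t, ht, hs l k hl.symm⟩⟩
  choose x hxM hmax using fun k => (Set.toFinite (M k)).exists_maximalFor (r k) _ (hne k)
  have hmax' : ∀ k, ∀ y ∈ M k, r k y ≤ r k (x k) := fun k y hy =>
    (le_total (r k y) (r k (x k))).elim id fun h => hmax k hy h
  have hxij : x i ≠ x j := fun h => Set.disjoint_left.1 hdisj (hxM i) (h ▸ hxM j)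
  have : extensions r T = {x i, x j} := by
    ext y
    rw [mem_extensions, hX]
    simp only [Finset.mem_insert, Finset.mem_singleton]
    constructor
    · rintro ⟨k, hk, hy, hym⟩
      have : y = x k := hr k (le_antisymm (hmax' k y hy) (hym _ (hxM k)))
      rcases hk with rfl | rfl <;> simp [this]
    · rintro (rfl | rfl)
      · exact ⟨i, Or.inl rfl, hxM i, hmax' i⟩
      · exact ⟨j, Or.inr rfl, hxM j, hmax' j⟩
  rw [this, Finset.card_pair hxij]
  exact even_two

/-- The set of all slack vectors but one extends in exactly one way: one of the two rankings of
the pivoting step is `i₀`, and for the other one, `j`, the set `M j` is empty. -/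
theorem card_extensions_slack {r : ι → V → α} (hr : ∀ i, Function.Injective (r i)) {s : ι → V}
    (hs : Function.Injective s) (hcard : 2 ≤ Fintype.card ι)
    (hmin : ∀ i v, r i (s i) ≤ r i v)
    (hbig : ∀ v, v ∉ Set.range s → ∀ i j, j ≠ i → r i v < r i (s j))
    {i₀ : ι} :
    (extensions r ((Finset.univ.erase i₀).image s)).card = 1 := by
  set T := (Finset.univ.erase i₀).image s with hTdef
  have hmemT : ∀ k, k ≠ i₀ → s k ∈ T := fun k hk => Finset.mem_image_of_mem _ (by simp [hk])
  have hcardT : T.card + 1 = Fintype.card ι := by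
    rw [hTdef, Finset.card_image_of_injective _ hs, Finset.card_erase_of_mem (Finset.mem_univ _),
      Finset.card_univ]
    omega
  have hne : T.Nonempty := Finset.card_pos.1 (by omega)
  have hmemT' : ∀ x ∈ T, ∃ k, k ≠ i₀ ∧ s k = x := by
    intro x hx
    obtain ⟨k, hk, rfl⟩ := Finset.mem_image.1 hx
    exact ⟨k, (Finset.mem_erase.1 hk).1, rfl⟩
  have hT : Dominating r T := by
    intro y
    by_cases hy : ∃ k, k ≠ i₀ ∧ y = s k
    · obtain ⟨k, hk, rfl⟩ := hy
      exact ⟨k, fun x _ => hmin k x⟩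
    · refine ⟨i₀, fun x hx => ?_⟩
      obtain ⟨k, hk, rfl⟩ := hmemT' x hx
      by_cases hyr : y ∈ Set.range s
      · obtain ⟨l, rfl⟩ := hyr
        have : l = i₀ := by by_contra h; exact hy ⟨l, h, rfl⟩
        subst this
        exact hmin _ _
      · exact (hbig y hyr i₀ k hk).le
  obtain ⟨i, j, M, hij, hM, ⟨t, htT, hti, htj⟩, hX, hdisj⟩ := hT.exists_critical_pair hr hne hcardT
  -- For `k ≠ i₀` the `r k`-smallest element of `T` is `s k`.
  have hmink : ∀ k, k ≠ i₀ → (∀ x ∈ T, r k t ≤ r k x) → t = s k := fun k hk h =>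
    hr k (le_antisymm (h _ (hmemT k hk)) (hmin k t))
  obtain ⟨j', hj', hcrit, hj'min⟩ : ∃ j', j' ≠ i₀ ∧ (∀ k, (k = i ∨ k = j) ↔ (k = i₀ ∨ k = j')) ∧
      (∀ x ∈ T, r i₀ t ≤ r i₀ x) ∧ t = s j' := by
    by_cases hi : i = i₀
    · subst hi
      exact ⟨j, hij.symm, fun k => Iff.rfl, hti, hmink j hij.symm htj⟩
    by_cases hj : j = i₀
    · subst hj
      exact ⟨i, hij, fun k => or_comm, htj, hmink i hij hti⟩
    · exact absurd (hs ((hmink i hi hti).symm.trans (hmink j hj htj))) hij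
  obtain ⟨hmin0, rfl⟩ := hj'min
  have hempty : M j' = ∅ := by
    rw [Set.eq_empty_iff_forall_notMem]
    intro y hy
    rw [hM] at hy
    obtain ⟨p, hp, hlt⟩ := hy i₀ hj'.symm
    have hlt' : r i₀ (s j') < r i₀ y := (hmin0 p hp).trans_lt hlt
    by_cases hyr : y ∈ Set.range s
    · obtain ⟨l, rfl⟩ := hyr
      by_cases hl0 : l = i₀
      · subst hl0; exact (hmin l _).not_gt hlt'
      by_cases hlj : l = j'
      · subst hlj; exact lt_irrefl _ hlt'
      · obtain ⟨q, -, hlt2⟩ := hy l hlj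
        exact (hmin l q).not_gt hlt2
    · exact (hbig y hyr i₀ j' hj').not_gt hlt'
  have hne0 : (M i₀).Nonempty := by
    refine ⟨s i₀, (hM _ _).2 fun l hl => ⟨s l, hmemT l hl, lt_of_le_of_ne (hmin l _) fun h => ?_⟩⟩
    exact hl (hs (hr l h))
  obtain ⟨x, hxM, hmax⟩ := (Set.toFinite (M i₀)).exists_maximalFor (r i₀) _ hne0
  have hmax' : ∀ y ∈ M i₀, r i₀ y ≤ r i₀ x := fun y hy =>
    (le_total (r i₀ y) (r i₀ x)).elim id fun h => hmax hy h
  rw [Finset.card_eq_one]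
  refine ⟨x, ?_⟩
  ext y
  rw [mem_extensions, hX, Finset.mem_singleton]
  constructor
  · rintro ⟨k, hk, hy, hym⟩
    rcases (hcrit k).1 hk with rfl | rfl
    · exact hr k (le_antisymm (hmax' y hy) (hym _ hxM))
    · simp [hempty] at hy
  · rintro rfl
    exact ⟨i₀, (hcrit i₀).2 (Or.inl rfl), hxM, hmax'⟩

/-- **Scarf's lemma**. Let the slack vector `s i` be smallest for the ranking `r i` and above all
non-slack elements for the other rankings, and let it have colour `i`. Then some dominating set
contains each colour exactly once. As in the proof of Sperner's lemma, the incident pairs of a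
dominating set and a subset with all colours but `i₀` are counted in two ways modulo two. -/
theorem exists_dominating_image_eq_univ {r : ι → V → α} (hr : ∀ i, Function.Injective (r i))
    {s : ι → V} (hcard : 2 ≤ Fintype.card ι) (hmin : ∀ i v, r i (s i) ≤ r i v)
    (hbig : ∀ v, v ∉ Set.range s → ∀ i j, j ≠ i → r i v < r i (s j))
    (c : V → ι) (hc : ∀ i, c (s i) = i) :
    ∃ B : Finset V, B.card = Fintype.card ι ∧ Dominating r B ∧ B.image c = Finset.univ := by
  classical
  by_contra! hcon
  have hs : Function.Injective s := fun i j h => by rw [← hc i, h, hc]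
  obtain ⟨i₀⟩ : Nonempty ι := Fintype.card_pos_iff.1 (by omega)
  -- A door is a set of one element less than there are colours which has all colours but `i₀`. The
  -- pairs of a dominating set `B` and a door `B.erase x` are listed by `B` in `P`, and by the door
  -- in `Q`.
  let P : Finset (Σ _ : Finset V, V) :=
    (Finset.univ.filter fun B : Finset V => B.card = Fintype.card ι ∧ Dominating r B).sigma
      fun B => B.filter fun x => (B.erase x).image c = Finset.univ.erase i₀
  let doors : Finset (Finset V) := Finset.univ.filter fun T : Finset V =>
    T.card + 1 = Fintype.card ι ∧ T.image c = Finset.univ.erase i₀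
  let Q : Finset (Σ _ : Finset V, V) := doors.sigma fun T => extensions r T
  have hPQ : P.card = Q.card := by
    refine Finset.card_nbij' (fun p => ⟨p.1.erase p.2, p.2⟩) (fun q => ⟨insert q.2 q.1, q.2⟩)
      ?_ ?_ ?_ ?_
    · rintro ⟨B, x⟩ h
      simp only [P, Q, doors, Finset.coe_sigma, Set.mem_sigma_iff, Finset.mem_coe,
        Finset.mem_filter, Finset.mem_univ, true_and, mem_extensions] at h ⊢
      obtain ⟨⟨h1, h2⟩, h3, h4⟩ := h
      refine ⟨⟨by rw [Finset.card_erase_add_one h3, h1], h4⟩, by simp, ?_⟩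
      rwa [Finset.insert_erase h3]
    · rintro ⟨T, x⟩ h
      simp only [P, Q, doors, Finset.coe_sigma, Set.mem_sigma_iff, Finset.mem_coe,
        Finset.mem_filter, Finset.mem_univ, true_and, mem_extensions] at h ⊢
      obtain ⟨⟨h1, h2⟩, h3, h4⟩ := h
      refine ⟨⟨by rw [Finset.card_insert_of_notMem h3, h1], h4⟩, by simp, ?_⟩
      rwa [Finset.erase_insert h3]
    · rintro ⟨B, x⟩ h
      simp only [P, Finset.coe_sigma, Set.mem_sigma_iff, Finset.mem_coe, Finset.mem_filter] at h
      simp [Finset.insert_erase h.2.1]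
    · rintro ⟨T, x⟩ h
      simp only [Q, Finset.coe_sigma, Set.mem_sigma_iff, Finset.mem_coe,
        mem_extensions] at h
      simp [Finset.erase_insert h.2.1]
  have hPeven : Even P.card := by
    rw [Finset.card_sigma]
    refine Finset.even_sum _ fun B hB => ?_
    obtain ⟨-, h1, h2⟩ := Finset.mem_filter.1 hB
    exact even_card_filter_image_erase c i₀ h1 (hcon B h1 h2)
  set T₀ := (Finset.univ.erase i₀).image s with hT₀
  have hT₀mem : T₀ ∈ doors := by
    refine Finset.mem_filter.2 ⟨Finset.mem_univ _, ?_, ?_⟩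
    · rw [hT₀, Finset.card_image_of_injective _ hs,
        Finset.card_erase_of_mem (Finset.mem_univ _), Finset.card_univ]
      omega
    · rw [hT₀, Finset.image_image]
      have : c ∘ s = id := funext hc
      rw [this, Finset.image_id]
  have hQodd : Odd Q.card := by
    rw [Finset.card_sigma, ← Finset.add_sum_erase _ _ hT₀mem,
      card_extensions_slack hr hs hcard hmin hbig, add_comm]
    refine Even.add_one (Finset.even_sum _ fun T hT => ?_)
    obtain ⟨hTne, hT⟩ := Finset.mem_erase.1 hT
    obtain ⟨-, h1, h2⟩ := Finset.mem_filter.1 hT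
    -- A door other than `T₀` contains an element which is not a slack vector.
    obtain ⟨t, ht, hts⟩ : ∃ t ∈ T, t ∉ Set.range s := by
      by_contra! hall
      apply hTne
      refine Finset.eq_of_subset_of_card_le (fun t ht => ?_) ?_
      · obtain ⟨k, rfl⟩ := hall t ht
        have : c (s k) ∈ T.image c := Finset.mem_image_of_mem _ ht
        rw [h2, hc] at this
        exact Finset.mem_image_of_mem _ this
      · have := (Finset.mem_filter.1 hT₀mem).2.1
        omega
    exact even_card_extensions hr h1 ht (hbig t hts)
  rw [← hPQ] at hQodd
  exact (Nat.not_even_iff_odd.2 hQodd) hPeven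

end Scarf

/-! ### A covering lemma for the simplex -/

section Covering

/-- A limit of points whose distances to a closed set tend to zero lies in the set. -/
theorem mem_of_tendsto_of_dist_le {X : Type*} [PseudoMetricSpace X] {s : Set X} (hs : IsClosed s)
    {z : ℕ → X} {x : X} (hz : Filter.Tendsto z Filter.atTop (nhds x)) {err : ℕ → ℝ}
    (herr : Filter.Tendsto err Filter.atTop (nhds 0))
    (h : ∀ᶠ k in Filter.atTop, ∃ w ∈ s, dist (z k) w ≤ err k) : x ∈ s := by
  rw [← hs.closure_eq, Metric.mem_closure_iff]
  intro ε hε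
  obtain ⟨k, ⟨w, hw, hzw⟩, hk, hkx⟩ := (h.and ((herr.eventually_lt_const (half_pos hε)).and
    (Metric.tendsto_nhds.1 hz _ (half_pos hε)))).exists
  exact ⟨w, hw, by linarith [dist_triangle_left x w (z k)]⟩

variable {ι : Type*} [Fintype ι]

/-- Scarf's lemma on the grid `{t : ι → ℕ | ∑ i, t i = N}`, whose points are ranked by their
coordinates. Up to an error of `card ι`, there is a grid point which for each `i` has vanishing
`i`-th coordinate or is close to a grid point of colour `i`. -/
theorem exists_grid_point (hcard : 2 ≤ Fintype.card ι) (N : ℕ) (c : (ι → ℕ) → ι) :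
    ∃ t : ι → ℕ, ∑ i, t i = N ∧ ∀ i, t i < Fintype.card ι ∨
      ∃ w : ι → ℕ, ∑ i, w i = N ∧ c w = i ∧
        ∀ k, t k < w k + Fintype.card ι ∧ w k < t k + Fintype.card ι := by
  classical
  obtain ⟨i₀⟩ : Nonempty ι := Fintype.card_pos_iff.1 (by omega)
  let T := {f : ι → ℕ // f ∈ Finset.piAntidiag Finset.univ N}
  let _ : Fintype T := Finset.Subtype.fintype _
  have hmemT : ∀ f : ι → ℕ, f ∈ Finset.piAntidiag Finset.univ N ↔ ∑ i, f i = N := by simp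
  have hTsum : ∀ t : T, ∑ i, t.1 i = N := fun t => (hmemT _).1 t.2
  have hTle : ∀ (t : T) i, t.1 i ≤ N := fun t i =>
    (Finset.single_le_sum (fun _ _ => Nat.zero_le _) (Finset.mem_univ i)).trans_eq (hTsum t)
  let e := Fintype.equivFin T
  let e' := Fintype.equivFin ι
  -- Ties between coordinates are broken by an enumeration; `Sum.inr j` are the slack vectors.
  let r : ι → T ⊕ ι → ℕ ×ₗ ℕ := fun i => Sum.elim (fun t => toLex (t.1 i + 1, (e t : ℕ)))
    fun j => if j = i then toLex (0, 0) else toLex (N + 2, (e' j : ℕ))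
  have hrl : ∀ i t, r i (Sum.inl t) = toLex (t.1 i + 1, (e t : ℕ)) := fun _ _ => rfl
  have hrr : ∀ i, r i (Sum.inr i) = toLex (0, 0) := fun _ => by simp [r]
  have hrr' : ∀ i j, j ≠ i → r i (Sum.inr j) = toLex (N + 2, (e' j : ℕ)) := fun _ _ h => by
    simp [r, h]
  have hr : ∀ i, Function.Injective (r i) := by
    rintro i (t | j) (t' | j') h
    · rw [hrl, hrl, EmbeddingLike.apply_eq_iff_eq, Prod.mk.injEq] at h
      rw [e.injective (Fin.ext h.2)]
    · by_cases hj : j' = i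
      · rw [hj, hrl, hrr, EmbeddingLike.apply_eq_iff_eq, Prod.mk.injEq] at h; omega
      · rw [hrl, hrr' _ _ hj, EmbeddingLike.apply_eq_iff_eq, Prod.mk.injEq] at h
        have := hTle t i; omega
    · by_cases hj : j = i
      · rw [hj, hrl, hrr, EmbeddingLike.apply_eq_iff_eq, Prod.mk.injEq] at h; omega
      · rw [hrl, hrr' _ _ hj, EmbeddingLike.apply_eq_iff_eq, Prod.mk.injEq] at h
        have := hTle t' i; omega
    · by_cases hj : j = i <;> by_cases hj' : j' = i
      · rw [hj, hj']
      · rw [hj, hrr, hrr' _ _ hj', EmbeddingLike.apply_eq_iff_eq, Prod.mk.injEq] at h; omega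
      · rw [hj', hrr, hrr' _ _ hj, EmbeddingLike.apply_eq_iff_eq, Prod.mk.injEq] at h; omega
      · rw [hrr' _ _ hj, hrr' _ _ hj', EmbeddingLike.apply_eq_iff_eq, Prod.mk.injEq] at h
        rw [e'.injective (Fin.ext h.2)]
  have hmin : ∀ i v, r i (Sum.inr i) ≤ r i v := by
    rintro i (t | j)
    · rw [hrr, hrl, Prod.Lex.toLex_le_toLex]; left; simp
    · by_cases hj : j = i
      · rw [hj]
      · rw [hrr, hrr' _ _ hj, Prod.Lex.toLex_le_toLex]; left; simp
  have hbig : ∀ v, v ∉ Set.range (Sum.inr : ι → T ⊕ ι) → ∀ i j, j ≠ i →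
      r i v < r i (Sum.inr j) := by
    rintro (t | j) hv i k hk
    · rw [hrl, hrr' _ _ hk, Prod.Lex.toLex_lt_toLex]
      left; have := hTle t i; simp only; omega
    · exact absurd ⟨j, rfl⟩ hv
  obtain ⟨B, hBcard, hBdom, hBc⟩ := exists_dominating_image_eq_univ hr hcard hmin hbig
    (Sum.elim (fun t => c t.1) id) (fun _ => rfl)
  have hdom : ∀ y : T, ∃ i, Sum.inr i ∉ B ∧ ∀ t : T, Sum.inl t ∈ B → y.1 i ≤ t.1 i := by
    intro y
    obtain ⟨i, hi⟩ := hBdom (Sum.inl y)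
    refine ⟨i, fun h => ?_, fun t ht => ?_⟩
    · have := hi _ h
      rw [hrr, hrl, Prod.Lex.toLex_le_toLex] at this
      simp at this
    · have := hi _ ht
      rw [hrl, hrl, Prod.Lex.toLex_le_toLex] at this
      simp only at this; omega
  have hcol : ∀ i, Sum.inr i ∉ B → ∃ w : T, Sum.inl w ∈ B ∧ c w.1 = i := by
    intro i hi
    have : i ∈ B.image (Sum.elim (fun t : T => c t.1) id) := by rw [hBc]; simp
    obtain ⟨w | j, hw, rfl⟩ := Finset.mem_image.1 this
    · exact ⟨w, hw, rfl⟩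
    · exact absurd hw hi
  -- `m i` is the smallest `i`-th coordinate in `B`, where slack vectors count as zero.
  have hm : ∀ i, ∃ m : ℕ, (∀ t : T, Sum.inl t ∈ B → m ≤ t.1 i) ∧
      (Sum.inr i ∈ B → m = 0) ∧ (Sum.inr i ∉ B → ∃ t : T, Sum.inl t ∈ B ∧ t.1 i = m) := by
    intro i
    by_cases hi : Sum.inr i ∈ B
    · exact ⟨0, fun _ _ => Nat.zero_le _, fun _ => rfl, fun h => absurd hi h⟩
    · obtain ⟨w, hw, -⟩ := hcol i hi
      obtain ⟨t, ht, hmin⟩ := (Set.toFinite {t : T | Sum.inl t ∈ B}).exists_minimalFor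
        (fun t => t.1 i) _ ⟨w, hw⟩
      exact ⟨t.1 i, fun t' ht' => (le_total _ _).elim id fun h => hmin ht' h,
        fun h => absurd h hi, fun _ => ⟨t, ht, rfl⟩⟩
  choose m hmle hm0 hmatt using hm
  have hsum : N < ∑ i, m i + Fintype.card ι := by
    by_contra! h
    -- Otherwise a grid point with all coordinates larger than those of `m` contradicts dominance.
    have h1 : ∑ i, (m i + 1) ≤ N := by
      rw [Finset.sum_add_distrib]; simpa using h
    obtain ⟨i, hi, hy⟩ := hdom ⟨fun i => m i + 1 + if i = i₀ then N - ∑ i, (m i + 1) else 0, by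
      rw [hmemT, Finset.sum_add_distrib]
      simp only [Finset.sum_ite_eq', Finset.mem_univ, if_true]
      omega⟩
    obtain ⟨t, ht, hti⟩ := hmatt i hi
    have := hy t ht
    simp only at this
    omega
  have hupper : ∀ t : T, Sum.inl t ∈ B → ∀ k, t.1 k < m k + Fintype.card ι := by
    intro t ht k
    have h1 : ∑ i ∈ Finset.univ.erase k, m i ≤ ∑ i ∈ Finset.univ.erase k, t.1 i :=
      Finset.sum_le_sum fun i _ => hmle i t ht
    have h2 := Finset.add_sum_erase Finset.univ m (Finset.mem_univ k)
    have h3 := Finset.add_sum_erase Finset.univ t.1 (Finset.mem_univ k)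
    have h4 := hTsum t
    omega
  obtain ⟨i₁, hi₁, -⟩ := hdom ⟨Pi.single i₀ N, by rw [hmemT]; simp⟩
  obtain ⟨t, ht, -⟩ := hcol i₁ hi₁
  refine ⟨t.1, hTsum t, fun i => ?_⟩
  by_cases hi : Sum.inr i ∈ B
  · left; have := hupper t ht i; rw [hm0 i hi] at this; omega
  · right
    obtain ⟨w, hw, hcw⟩ := hcol i hi
    refine ⟨w.1, hTsum w, hcw, fun k => ?_⟩
    have h1 := hupper t ht k
    have h2 := hupper w hw k
    have h3 := hmle k t ht
    have h4 := hmle k w hw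
    omega

/-- A covering lemma equivalent to Brouwer's fixed point theorem: if closed sets `D i` cover the
simplex, some point `z` of it lies in `D i` for all `i` with `z i ≠ 0`. -/
theorem exists_mem_stdSimplex_forall_eq_zero_or_mem (hcard : 2 ≤ Fintype.card ι)
    {D : ι → Set (ι → ℝ)} (hclosed : ∀ i, IsClosed (D i))
    (hcover : stdSimplex ℝ ι ⊆ ⋃ i, D i) :
    ∃ z ∈ stdSimplex ℝ ι, ∀ i, z i = 0 ∨ z ∈ D i := by
  set n := Fintype.card ι with hn
  -- Colour the grid point `t` by some `i` with `t / N ∈ D i`.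
  have happrox : ∀ N : ℕ, ∃ z ∈ stdSimplex ℝ ι, ∀ i, z i ≤ n * (1 / ((N : ℝ) + 1)) ∨
      ∃ w ∈ D i, dist z w ≤ n * (1 / ((N : ℝ) + 1)) := by
    intro N
    have hpos : (0 : ℝ) < (N : ℝ) + 1 := by positivity
    have hgrid : ∀ t : ι → ℕ, ∑ i, t i = N + 1 →
        (fun i => (t i : ℝ) / ((N : ℝ) + 1)) ∈ stdSimplex ℝ ι := by
      intro t ht
      refine ⟨fun i => by positivity, ?_⟩
      rw [← Finset.sum_div, ← Nat.cast_sum, ht]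
      push_cast
      exact div_self hpos.ne'
    have hc : ∀ t : ι → ℕ, ∃ i, ∑ i, t i = N + 1 →
        (fun i => (t i : ℝ) / ((N : ℝ) + 1)) ∈ D i := by
      intro t
      by_cases ht : ∑ i, t i = N + 1
      · obtain ⟨i, hi⟩ := Set.mem_iUnion.1 (hcover (hgrid t ht))
        exact ⟨i, fun _ => hi⟩
      · obtain ⟨i₀⟩ : Nonempty ι := Fintype.card_pos_iff.1 (by omega)
        exact ⟨i₀, fun h => absurd h ht⟩
    choose c hc using hc
    obtain ⟨t, ht, h⟩ := exists_grid_point hcard (N + 1) c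
    refine ⟨_, hgrid t ht, fun i => (h i).imp (fun hi => ?_) ?_⟩
    · rw [mul_one_div]
      gcongr
    · rintro ⟨w, hw, rfl, hk⟩
      refine ⟨_, hc w hw, (dist_pi_le_iff (by positivity)).2 fun k => ?_⟩
      rw [Real.dist_eq, ← sub_div, abs_div, abs_of_pos hpos, mul_one_div]
      gcongr
      have h1 : (t k : ℝ) ≤ w k + n := by exact_mod_cast (hk k).1.le
      have h2 : (w k : ℝ) ≤ t k + n := by exact_mod_cast (hk k).2.le
      rw [abs_le]
      constructor <;> linarith
  choose z hz hzD using happrox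
  obtain ⟨x, hx, φ, hφ, hlim⟩ := (isCompact_stdSimplex ℝ ι).tendsto_subseq hz
  have herr : Filter.Tendsto (fun k => (n : ℝ) * (1 / ((φ k : ℝ) + 1))) Filter.atTop
      (nhds 0) := by
    have := (tendsto_one_div_add_atTop_nhds_zero_nat (𝕜 := ℝ)).const_mul (n : ℝ)
    rw [mul_zero] at this
    exact this.comp hφ.tendsto_atTop
  refine ⟨x, hx, fun i => ?_⟩
  by_cases hxi : x i = 0
  · exact Or.inl hxi
  right
  have hev : ∀ᶠ k in Filter.atTop, n * (1 / ((φ k : ℝ) + 1)) < z (φ k) i :=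
    herr.eventually_lt ((continuous_apply i).continuousAt.tendsto.comp hlim)
      (lt_of_le_of_ne (hx.1 i) (Ne.symm hxi))
  exact mem_of_tendsto_of_dist_le (hclosed i) hlim herr
    (hev.mono fun k hk => (hzD (φ k) i).resolve_left hk.not_ge)

end Covering

/-! ### Selecting convex combinations for several covers -/

section Selection

variable {ι J : Type*} [Fintype ι] [Fintype J]

/-- Approximate form of `exists_matrix_of_closed_covers`, obtained from partitions of unity
subordinate to the `δ`-thickenings of the covers. -/
theorem exists_matrix_thickening (hcard : 2 ≤ Fintype.card ι) {D : J → ι → Set (ι → ℝ)}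
    (hcover : ∀ j, stdSimplex ℝ ι ⊆ ⋃ i, D j i) {δ : ℝ} (hδ : 0 < δ) :
    ∃ z ∈ stdSimplex ℝ ι, ∃ A : J → ι → ℝ, (∀ j, A j ∈ stdSimplex ℝ ι) ∧
      (∀ j i, A j i ≠ 0 → z ∈ Metric.thickening δ (D j i)) ∧
      ∀ i, z i = 0 ∨ (Fintype.card J : ℝ) / Fintype.card ι ≤ ∑ j, A j i := by
  let f : J → ι → (ι → ℝ) → ℝ := fun j i z => (thickenedIndicator hδ (D j i) z : NNReal)
  have hf : ∀ j i, Continuous (f j i) := fun j i =>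
    NNReal.continuous_coe.comp (thickenedIndicator hδ (D j i)).continuous
  have hf0 : ∀ j i z, 0 ≤ f j i z := fun j i z => NNReal.coe_nonneg _
  have hsum : ∀ j, ∀ z ∈ stdSimplex ℝ ι, 1 ≤ ∑ i, f j i z := by
    intro j z hz
    obtain ⟨i, hi⟩ := Set.mem_iUnion.1 (hcover j hz)
    have h1 : f j i z = 1 :=
      (congrArg NNReal.toReal (thickenedIndicator_one hδ (D j i) hi)).trans NNReal.coe_one
    rw [← h1]
    exact Finset.single_le_sum (fun k _ => hf0 j k z) (Finset.mem_univ i)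
  -- On the simplex the denominator is the sum of the numerators.
  let A : (ι → ℝ) → J → ι → ℝ := fun z j i => f j i z / max 1 (∑ i, f j i z)
  have hA : ∀ z ∈ stdSimplex ℝ ι, ∀ j, A z j ∈ stdSimplex ℝ ι := by
    intro z hz j
    refine ⟨fun i => div_nonneg (hf0 j i z) (by positivity), ?_⟩
    simp only [A]
    rw [← Finset.sum_div, max_eq_right (hsum j z hz)]
    exact div_self (zero_lt_one.trans_le (hsum j z hz)).ne'
  have hAcont : ∀ j i, Continuous fun z => A z j i := by
    intro j i
    refine (hf j i).div (continuous_const.max (continuous_finsetSum _ fun i _ => hf j i)) ?_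
    intro z
    positivity
  obtain ⟨z, hz, hzA⟩ := exists_mem_stdSimplex_forall_eq_zero_or_mem hcard
    (D := fun i => {z | (Fintype.card J : ℝ) / Fintype.card ι ≤ ∑ j, A z j i})
    (fun i => isClosed_le continuous_const (continuous_finsetSum _ fun j _ => hAcont j i)) (by
      intro z hz
      rw [Set.mem_iUnion]
      obtain ⟨i, -, hi⟩ := Finset.exists_le_of_sum_le (s := Finset.univ)
        (f := fun _ : ι => (Fintype.card J : ℝ) / Fintype.card ι) (g := fun i => ∑ j, A z j i)
        (Finset.card_pos.1 (by rw [Finset.card_univ]; omega)) (by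
          rw [Finset.sum_comm, Finset.sum_congr rfl fun j _ => (hA z hz j).2]
          have : (Fintype.card ι : ℝ) ≠ 0 := by
            have : Fintype.card ι ≠ 0 := by omega
            exact_mod_cast this
          simp [mul_div_cancel₀ _ this])
      exact ⟨i, hi⟩)
  refine ⟨z, hz, A z, hA z hz, fun j i hji => ?_, hzA⟩
  by_contra hnot
  apply hji
  have : f j i z = 0 :=
    (congrArg NNReal.toReal (thickenedIndicator_zero hδ (D j i) hnot)).trans NNReal.coe_zero
  simp [A, this]

/-- A version of Kakutani's theorem for several closed covers `D j` of the simplex: at some point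
`z`, each cover has a convex combination of the labels of its members containing `z`, such that each
label with `z i ≠ 0` has at least the average total weight. Both the support condition and the
alternatives at the end survive the passage to the limit. -/
theorem exists_matrix_of_closed_covers (hcard : 2 ≤ Fintype.card ι) {D : J → ι → Set (ι → ℝ)}
    (hclosed : ∀ j i, IsClosed (D j i)) (hcover : ∀ j, stdSimplex ℝ ι ⊆ ⋃ i, D j i) :
    ∃ z ∈ stdSimplex ℝ ι, ∃ A : J → ι → ℝ, (∀ j, A j ∈ stdSimplex ℝ ι) ∧
      (∀ j i, A j i ≠ 0 → z ∈ D j i) ∧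
      ∀ i, z i = 0 ∨ (Fintype.card J : ℝ) / Fintype.card ι ≤ ∑ j, A j i := by
  choose z hz A hA hAz hzA using fun N : ℕ =>
    exists_matrix_thickening hcard hcover (Nat.one_div_pos_of_nat (α := ℝ) (n := N))
  have hcomp : IsCompact (stdSimplex ℝ ι ×ˢ Set.univ.pi fun _ : J => stdSimplex ℝ ι) :=
    (isCompact_stdSimplex ℝ ι).prod (isCompact_univ_pi fun _ => isCompact_stdSimplex ℝ ι)
  obtain ⟨⟨x, X⟩, ⟨hx, hX⟩, φ, hφ, hlim⟩ :=
    hcomp.tendsto_subseq (x := fun N => (z N, A N)) fun N => ⟨hz N, fun j _ => hA N j⟩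
  have hzlim : Filter.Tendsto (fun k => z (φ k)) Filter.atTop (nhds x) :=
    (continuous_fst.tendsto _).comp hlim
  have hAlim : ∀ j i, Filter.Tendsto (fun k => A (φ k) j i) Filter.atTop (nhds (X j i)) :=
    fun j i => ((continuous_apply_apply j i).tendsto _).comp ((continuous_snd.tendsto _).comp hlim)
  refine ⟨x, hx, X, fun j => hX j trivial, fun j i hji => ?_, fun i => ?_⟩
  · refine mem_of_tendsto_of_dist_le (hclosed j i) hzlim
      ((tendsto_one_div_add_atTop_nhds_zero_nat (𝕜 := ℝ)).comp hφ.tendsto_atTop) ?_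
    filter_upwards [(hAlim j i).eventually_ne hji] with k hk
    obtain ⟨w, hw, hd⟩ := Metric.mem_thickening_iff.1 (hAz (φ k) j i hk)
    exact ⟨w, hw, hd.le⟩
  · by_cases hxi : x i = 0
    · exact Or.inl hxi
    · right
      refine ge_of_tendsto (tendsto_finsetSum Finset.univ fun j _ => hAlim j i) ?_
      filter_upwards [(((continuous_apply i).tendsto _).comp hzlim).eventually_ne hxi] with k hk
      exact (hzA (φ k) i).resolve_left hk

end Selection

/-! ### Matchings that avoid a given room -/

section Matching

variable {ι J : Type*} [Fintype ι] [Fintype J]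

/-- If the rows of a nonnegative `n × (n + 1)` matrix have sum `1` and its columns have sum at least
`n / (n + 1)`, then after removing any column the support contains a perfect matching: any nonempty
set of rows has its support in strictly more columns, so that Hall's condition survives. -/
theorem exists_equiv_ne_of_column_sums (hcard : Fintype.card ι = Fintype.card J + 1)
    {A : J → ι → ℝ} (hA : ∀ j, A j ∈ stdSimplex ℝ ι)
    (hcol : ∀ i, (Fintype.card J : ℝ) / Fintype.card ι ≤ ∑ j, A j i) (i : ι) :
    ∃ π : J ≃ {k : ι // k ≠ i}, ∀ j, A j (π j) ≠ 0 := by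
  classical
  let t : J → Finset {k : ι // k ≠ i} := fun j => Finset.univ.filter fun k => A j k ≠ 0
  have hall : ∀ I : Finset J, I.card ≤ (I.biUnion t).card := by
    intro I
    rcases I.eq_empty_or_nonempty with rfl | hI
    · simp
    set N : Finset ι := I.biUnion fun j => Finset.univ.filter fun k => A j k ≠ 0 with hN
    have hsub : N.erase i ⊆ (I.biUnion t).map (Function.Embedding.subtype _) := by
      intro k hk
      obtain ⟨hki, hk⟩ := Finset.mem_erase.1 hk
      obtain ⟨j, hj, hk⟩ := Finset.mem_biUnion.1 hk
      refine Finset.mem_map.2 ⟨⟨k, hki⟩, Finset.mem_biUnion.2 ⟨j, hj, ?_⟩, rfl⟩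
      simpa [t] using hk
    have h1 := Finset.card_le_card hsub
    rw [Finset.card_map] at h1
    have h2 := Finset.pred_card_le_card_erase (s := N) (a := i)
    suffices I.card < N.card by omega
    have h3 : (I.card : ℝ) ≤ ∑ k ∈ N, ∑ j, A j k := by
      calc (I.card : ℝ) = ∑ j ∈ I, ∑ k ∈ N, A j k := by
            rw [Finset.sum_congr rfl (g := fun _ => (1 : ℝ)) (fun j hj => ?_)]
            · simp
            rw [← (hA j).2]
            refine Finset.sum_subset (Finset.subset_univ _) fun k _ hk => ?_
            by_contra h
            exact hk (Finset.mem_biUnion.2 ⟨j, hj, by simpa using h⟩)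
        _ = ∑ k ∈ N, ∑ j ∈ I, A j k := Finset.sum_comm
        _ ≤ ∑ k ∈ N, ∑ j, A j k := Finset.sum_le_sum fun k _ =>
            Finset.sum_le_sum_of_subset_of_nonneg (Finset.subset_univ _) fun j _ _ => (hA j).1 k
    have h4 : ∑ k ∈ N, ∑ j, A j k + ∑ k ∈ Nᶜ, ∑ j, A j k = Fintype.card J := by
      rw [Finset.sum_add_sum_compl, Finset.sum_comm, Finset.sum_congr rfl fun j _ => (hA j).2]
      simp
    have h5 : ((Nᶜ).card : ℝ) * ((Fintype.card J : ℝ) / Fintype.card ι) ≤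
        ∑ k ∈ Nᶜ, ∑ j, A j k := by
      rw [← nsmul_eq_mul, ← Finset.sum_const]
      exact Finset.sum_le_sum fun k _ => hcol k
    have h6 : (N.card : ℝ) + (Nᶜ).card = Fintype.card ι := by
      exact_mod_cast N.card_add_card_compl
    have hpos : (0 : ℝ) < Fintype.card ι := by rw [hcard]; positivity
    have h7 : (Fintype.card ι : ℝ) * ((Fintype.card J : ℝ) / Fintype.card ι) = Fintype.card J :=
      mul_div_cancel₀ _ hpos.ne'
    have h8 : (I.card : ℝ) ≤ N.card * ((Fintype.card J : ℝ) / Fintype.card ι) := by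
      rw [← h6] at h7
      rw [← h6] at h5 ⊢
      linarith
    rw [mul_div_assoc', le_div_iff₀ hpos, hcard] at h8
    have h9 : I.card * (Fintype.card J + 1) ≤ N.card * Fintype.card J := by exact_mod_cast h8
    by_contra! h
    have h10 := Nat.mul_le_mul_right (Fintype.card J) h
    have := hI.card_pos
    rw [mul_add] at h9
    omega
  obtain ⟨π, hπ, hmem⟩ := (Finset.all_card_le_biUnion_card_iff_exists_injective t).1 hall
  have hcard' : Fintype.card J = Fintype.card {k : ι // k ≠ i} := by
    rw [Fintype.card_subtype_compl, hcard]; simp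
  refine ⟨Equiv.ofBijective π ((Fintype.bijective_iff_injective_and_card π).2 ⟨hπ, hcard'⟩),
    fun j => ?_⟩
  simpa [t] using hmem j

end Matching

/-! ### Dual KKM covers -/

section DualKKM

/-- The retraction by which the simplex is enlarged: the coordinates are decreased by `δ`, cut off
at zero and normalised. -/
noncomputable def shrinkSimplex {ι : Type*} [Fintype ι] (δ : ℝ) (z : ι → ℝ) : ι → ℝ :=
  fun i => max (z i - δ) 0 / ∑ k, max (z k - δ) 0

variable {ι : Type*} [Fintype ι] {δ : ℝ} {z : ι → ℝ}

theorem exists_lt_of_mem_stdSimplex (hδ : Fintype.card ι * δ < 1) (hz : z ∈ stdSimplex ℝ ι) :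
    ∃ k, δ < z k := by
  by_contra! h
  have h1 : ∑ k, z k ≤ Fintype.card ι * δ := by
    simpa using Finset.sum_le_sum fun k (_ : k ∈ Finset.univ) => h k
  rw [hz.2] at h1
  linarith

theorem sum_max_sub_pos (hδ : Fintype.card ι * δ < 1) (hz : z ∈ stdSimplex ℝ ι) :
    0 < ∑ k, max (z k - δ) 0 := by
  obtain ⟨k, hk⟩ := exists_lt_of_mem_stdSimplex hδ hz
  exact Finset.sum_pos' (fun _ _ => le_max_right _ _)
    ⟨k, Finset.mem_univ k, lt_max_of_lt_left (sub_pos.2 hk)⟩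

theorem shrinkSimplex_mem (hδ : Fintype.card ι * δ < 1) (hz : z ∈ stdSimplex ℝ ι) :
    shrinkSimplex δ z ∈ stdSimplex ℝ ι := by
  refine ⟨fun i => div_nonneg (le_max_right _ _) (sum_max_sub_pos hδ hz).le, ?_⟩
  simp only [shrinkSimplex]
  rw [← Finset.sum_div]
  exact div_self (sum_max_sub_pos hδ hz).ne'

theorem shrinkSimplex_apply_eq_zero {i : ι} (h : z i ≤ δ) : shrinkSimplex δ z i = 0 := by
  rw [shrinkSimplex, max_eq_right (sub_nonpos.2 h), zero_div]

theorem continuousOn_shrinkSimplex (hδ : Fintype.card ι * δ < 1) :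
    ContinuousOn (shrinkSimplex δ) (stdSimplex ℝ ι) := by
  refine continuousOn_pi.2 fun i => ContinuousOn.div ?_ ?_ fun z hz => (sum_max_sub_pos hδ hz).ne'
  · exact Continuous.continuousOn (by fun_prop)
  · exact Continuous.continuousOn (by fun_prop)

/-- The pullback of a cover along `shrinkSimplex δ`. At points with some coordinate below `δ`, only
labels of coordinates at most `δ` are kept, as the boundary condition of dual KKM covers permits. -/
def enlargedCover (δ : ℝ) (C : ι → Set (ι → ℝ)) (i : ι) : Set (ι → ℝ) :=
  {z ∈ stdSimplex ℝ ι | shrinkSimplex δ z ∈ C i} ∩ ({z | z i ≤ δ} ∪ {z | ∀ k, δ ≤ z k})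

theorem isClosed_enlargedCover (hδ : Fintype.card ι * δ < 1) {C : ι → Set (ι → ℝ)}
    {i : ι} (hC : IsClosed (C i)) : IsClosed (enlargedCover δ C i) := by
  refine ((continuousOn_shrinkSimplex hδ).preimage_isClosed_of_isClosed
    (isClosed_stdSimplex ℝ ι) hC).inter ((isClosed_le (by fun_prop) (by fun_prop)).union ?_)
  simp only [Set.ofPred_forall]
  exact isClosed_iInter fun k => isClosed_le (by fun_prop) (by fun_prop)

theorem IsDualKKMCover.subset_iUnion_enlargedCover {d : ℕ} {C : Fin (d + 1) → Set (Fin (d + 1) → ℝ)}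
    (hC : IsDualKKMCover d C) (hδ : Fintype.card (Fin (d + 1)) * δ < 1) :
    stdSimplex ℝ (Fin (d + 1)) ⊆ ⋃ i, enlargedCover δ C i := by
  intro z hz
  have hr := shrinkSimplex_mem hδ hz
  rw [Set.mem_iUnion]
  by_cases h : ∀ k, δ ≤ z k
  · obtain ⟨i, hi⟩ := Set.mem_iUnion.1 (hC.iUnion_eq ▸ hr)
    exact ⟨i, ⟨hz, hi⟩, Or.inr h⟩
  · push Not at h
    obtain ⟨k, hk⟩ := h
    have hmem := hC.face_subset (Finset.univ.filter fun i => δ < z i)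
      (fun h => by have := Finset.mem_filter.1 (h ▸ Finset.mem_univ k); linarith [this.2])
      ⟨hr, fun i hi => shrinkSimplex_apply_eq_zero (by simpa using hi)⟩
    simp only [Set.mem_iUnion, Set.mem_ofPred_eq, Finset.mem_filter, Finset.mem_univ, true_and,
      not_lt, exists_prop] at hmem
    obtain ⟨i, hi, hiC⟩ := hmem
    exact ⟨i, ⟨hz, hiC⟩, Or.inl hi⟩

/-- Averaging over the tenants: there are a rent division `x` and, for each tenant, a convex
combination of rooms preferred at `x`, such that all rooms receive the same total weight (the lower
bound on the weights forces equality, as the weights sum to `d`). -/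
theorem exists_matrix_of_dualKKMCovers {d : ℕ} (hd : d ≠ 0)
    {C : Fin d → Fin (d + 1) → Set (Fin (d + 1) → ℝ)} (hC : ∀ j, IsDualKKMCover d (C j)) :
    ∃ x ∈ stdSimplex ℝ (Fin (d + 1)), ∃ A : Fin d → Fin (d + 1) → ℝ,
      (∀ j, A j ∈ stdSimplex ℝ (Fin (d + 1))) ∧ (∀ j i, A j i ≠ 0 → x ∈ C j i) ∧
      ∀ i, (Fintype.card (Fin d) : ℝ) / Fintype.card (Fin (d + 1)) ≤ ∑ j, A j i := by
  obtain ⟨δ, hδ0, hδ⟩ : ∃ δ : ℝ, 0 < δ ∧ Fintype.card (Fin (d + 1)) * δ < 1 := by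
    refine ⟨1 / (d + 2), by positivity, ?_⟩
    rw [Fintype.card_fin, mul_one_div, div_lt_one (by positivity)]
    push_cast
    linarith
  obtain ⟨z, hz, A, hA, hAz, hcol⟩ := exists_matrix_of_closed_covers
    (D := fun j => enlargedCover δ (C j)) (by rw [Fintype.card_fin]; omega)
    (fun j i => isClosed_enlargedCover hδ ((hC j).isClosed i))
    (fun j => (hC j).subset_iUnion_enlargedCover hδ)
  refine ⟨shrinkSimplex δ z, shrinkSimplex_mem hδ hz, A, hA, fun j i h => (hAz j i h).1.2,
    fun i => (hcol i).resolve_left fun hi => ?_⟩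
  -- If `z i = 0`, all rooms of positive weight have a small coordinate, hence all rooms do.
  obtain ⟨k, hk⟩ := exists_lt_of_mem_stdSimplex hδ hz
  have hk' := (hcol k).resolve_left (hδ0.trans hk).ne'
  have hpos : (0 : ℝ) < (Fintype.card (Fin d) : ℝ) / Fintype.card (Fin (d + 1)) := by
    rw [Fintype.card_fin, Fintype.card_fin]
    have : 0 < d := Nat.pos_of_ne_zero hd
    positivity
  obtain ⟨j, -, hj⟩ := Finset.exists_ne_zero_of_sum_ne_zero (hpos.trans_le hk').ne'
  rcases (hAz j k hj).2 with h | h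
  · exact hk.not_ge h
  · have h0 : δ ≤ z i := h i
    rw [hi] at h0
    exact hδ0.not_ge h0

end DualKKM

/-! ### Rent division with a secretive tenant -/

theorem mainTheorem7 (d : ℕ) (C : Fin d → Fin (d + 1) → Set (Fin (d + 1) → ℝ))
    (hC : ∀ j, IsDualKKMCover d (C j)) :
    ∃ x ∈ stdSimplex ℝ (Fin (d + 1)),
      (∀ i : Fin (d + 1), ∃ π : Fin d ≃ {k : Fin (d + 1) // k ≠ i}, ∀ j, x ∈ C j (π j)) ∧
      (∀ S : Fin (d + 1) → Set (Fin (d + 1) → ℝ),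
        stdSimplex ℝ (Fin (d + 1)) ⊆ ⋃ i, S i →
          IsEnvyFreeDivision d (Fin.cons S C) x) := by
  obtain ⟨x, hx, hπ⟩ : ∃ x ∈ stdSimplex ℝ (Fin (d + 1)), ∀ i : Fin (d + 1),
      ∃ π : Fin d ≃ {k : Fin (d + 1) // k ≠ i}, ∀ j, x ∈ C j (π j) := by
    rcases eq_or_ne d 0 with rfl | hd
    · refine ⟨fun _ => 1, ⟨fun _ => zero_le_one, by simp⟩, fun i => ?_⟩
      have : IsEmpty {k : Fin (0 + 1) // k ≠ i} :=
        ⟨fun k => k.2 (Subsingleton.elim (α := Fin 1) _ _)⟩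
      exact ⟨Equiv.equivOfIsEmpty _ _, fun j => j.elim0⟩
    · obtain ⟨x, hx, A, hA, hAC, hcol⟩ := exists_matrix_of_dualKKMCovers hd hC
      refine ⟨x, hx, fun i => ?_⟩
      obtain ⟨π, hπ⟩ := exists_equiv_ne_of_column_sums (by simp) hA hcol i
      exact ⟨π, fun j => hAC j _ (hπ j)⟩
  refine ⟨x, hx, hπ, fun S hS => ?_⟩
  obtain ⟨i, hi⟩ := Set.mem_iUnion.1 (hS hx)
  obtain ⟨π, hπ⟩ := hπ i
  -- The secretive tenant takes a room `i` she prefers, and the others are matched with the rest.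
  have hinj : Function.Injective (Fin.cons i fun j => (π j : Fin (d + 1)) :
      Fin (d + 1) → Fin (d + 1)) := by
    refine Fin.cons_injective_iff.2 ⟨?_, Subtype.val_injective.comp π.injective⟩
    rintro ⟨j, hj⟩
    exact (π j).2 hj
  refine ⟨Equiv.ofBijective _ (Finite.injective_iff_bijective.1 hinj), fun t => ?_⟩
  refine Fin.cases ?_ (fun j => ?_) t
  · simpa using hi
  · simpa using hπ j
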